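/- **Coarsely convex spaces.** Let $\lambda\ge1$, $k\ge0$, $E\ge1$, $C\ge0$, let $\theta:\mathbb R_{\ge0}\to\mathbb R_{\ge0}$ be non-decreasing, and let $\mathcal L$ be a family of $(\lambda,k)$-quasi-geodesic segments $\gamma:[0,a_\gamma]\to X$ (that is, $\lambda^{-1}|s-t|-k\le d(\gamma(s),\gamma(t))\le\lambda|s-t|+k$ for all $s,t$) in a metric space $X$. $X$ is *$(\lambda,k,E,C,\theta,\mathcal L)$-coarsely convex* if any two points $v,w\in X$ are joined by some $\gamma\in\mathcal L$ with $\gamma(0)=v$, $\gamma(a_\gamma)=w$, and for all $\gamma,\eta\in\mathcal L$, $t\in[0,a_\gamma]$, $s\in[0,a_\eta]$, $c\in[0,1]$, $$d(\gamma(ct),\eta(cs))\le cE\,d(\gamma(t),\eta(s))+(1-c)E\,d(\gamma(0),\eta(0))+C,$$ $$|t-s|\le\theta\big(d(\gamma(0),\eta(0))+d(\gamma(t),\eta(s))\big).$$ Put $k_1=\lambda+k$, $D=2(1+E)k_1+C$ and fix a base point $O\in X$. Let $\mathcal L_O$ be the set of $\gamma\in\mathcal L$ with $\gamma(0)=O$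 and $a_\gamma\ge2\theta(0)$. Let $\mathcal L_O^\infty$ be the set of maps $\gamma:\mathbb R_{\ge0}\to X$ with $\gamma(0)=O$ and $\gamma(t)=\gamma(\lfloor t\rfloor)$ for all $t$, for which there are $\gamma_n\in\mathcal L$ with $\gamma_n(0)=O$, $a_{\gamma_n}\to\infty$ and $\gamma_n(m)\to\gamma(m)$ for every $m\in\mathbb N$. The *ideal boundary* $\partial X=\partial_OX$ is $\mathcal L_O^\infty$ modulo the relation $\sup_t d(\gamma(t),\eta(t))<\infty$. For $\gamma,\eta\in\mathcal L_O\cup\mathcal L_O^\infty$ put $$(\gamma\mid\eta)_O=\sup\{t\in\operatorname{Dom}\gamma\cap\operatorname{Dom}\eta: d(\gamma(t),\eta(t))\le2D+2\}.$$ For $x,y\in X\cup\partial_OX$ put $(x\mid y)_O=0$ if $x$ or $y$ lies in the closed ball $\bar B(O,2\lambda\theta(0)+k)\subset X$, and otherwise $(x\mid y)_O=\sup(\gamma\mid\eta)_O$ over $\gamma$ from $O$ to $x$ and $\eta$ from $O$ to $y$, where a curve from $O$ to a point $z\in X$ is a $\gamma\in\mathcal L_O$ with $\gamma(a_\gamma)=z$,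 and a curve from $O$ to $z\in\partial_OX$ is a representative $\gamma\in\mathcal L_O^\infty$ of $z$. The sets $V_n(z)$, $n\ge1$, form a neighbourhood basis of $z\in X\cup\partial_OX$, where $V_n(z)$ consists of all $w$ with $(z\mid w)_O>n$, or with $z,w\in X$ and $d(z,w)<1/n$. For $\epsilon>0$, a metric $d_\epsilon$ on $\partial_OX$ *of the type considered here* is one such that, for some constant $0<K<1$, $$K\,(x\mid y)_O^{-\epsilon}\le d_\epsilon(x,y)\le(x\mid y)_O^{-\epsilon}\qquad(x,y\in\partial_OX),\quad \infty^{-\epsilon}=0.$$ **Maps.** A *rough-isometric contraction* is a non-decreasing map $\sigma:\mathbb R_{\ge0}\to\mathbb R_{\ge0}$ with $\sigma(0)=0$, $\sigma(t)\to\infty$ as $t\to\infty$, $\sigma(t)\le t$, and for some $\tau,B\ge0$ and $A>0$, $A|t-s|-B\le|\sigma(t)-\sigma(s)|\le|t-s|+\tau$ for all $s,t$. Let $X$ and $Y$ be coarsely convex with systems $\mathcal L^X$, $\mathcal L^Y$ and base points $a\in X$, $b\in Y$, and let $f:X\to Y$. - $f$ is *large scale Lipschitz* if for some $A\ge1$,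 $B\ge0$, $d(f(x),f(x'))\le A\,d(x,x')+B$ for all $x,x'$. - $f$ is *$\sigma$-$\mathcal L^X_a$-radial* if $\sigma(t)\le d(f(\gamma(t)),f(a))$ for all $\gamma\in\mathcal L^X_a$ and $t\in\operatorname{Dom}\gamma$. - $f$ is *$\rho$-$H$-$\mathcal L^X_a$-$\mathcal L^Y_b$-equivariant* if $f(a)=b$ and, for all $\gamma\in\mathcal L^X_a$ and $\eta\in\mathcal L^Y_b$ with $\eta(a_\eta)=f(\gamma(a_\gamma))$, one has $d(f(\gamma(t)),\eta(\rho(t)))<H$ for all $t\in[0,a_\gamma]$ with $\rho(t)\le a_\eta$. - A large scale Lipschitz map $f$ is *visual* if $(x_n\mid y_n)_a\to\infty$ implies $(f(x_n)\mid f(y_n))_b\to\infty$ for all sequences $(x_n),(y_n)$ in $X$. - A map $\partial f:\partial_aX\to\partial_bY$ is *induced by* $f$ if for all $x\in\partial_aX$ and every representative $\gamma\in\mathcal L_a^{X,\infty}$ of $x$, $f(\gamma(n))\to\partial f(x)$ in $Y\cup\partial_bY$. **Corollary.** Let $X$ and $Y$ be proper coarsely convex spaces with systems of good quasi-geodesic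 segments $\mathcal L^X$, $\mathcal L^Y$ and base points $a\in X$, $b\in Y$. Let $\sigma,\rho:\mathbb R_{\ge0}\to\mathbb R_{\ge0}$ be rough-isometric contractions and let $H>0$. Let $f:X\to Y$ be a large scale Lipschitz, $\sigma$-$\mathcal L^X_a$-radial and $\rho$-$H$-$\mathcal L^X_a$-$\mathcal L^Y_b$-equivariant map (in particular $f(a)=b$). Then $f$ is visual, it has a unique induced map $\partial f:\partial_aX\to\partial_bY$, and $\partial f$ is Lipschitz with respect to the metrics $d_\epsilon$. That is, for all sufficiently small $\epsilon>0$ metrics $d_\epsilon$ of the above type exist on $\partial_aX$ and on $\partial_bY$, and for every $\epsilon>0$ and every such pair of metrics there is $M\ge0$ with $$d_\epsilon(\partial f(x),\partial f(y))\le M\,d_\epsilon(x,y)\qquad\text{for all }x,y\in\partial_aX.$$ -/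

import Mathlib

open Filter Topology Set
open scoped NNReal ENNReal

/-! ### Segments, curves and coarsely convex spaces -/

/-- A (not necessarily continuous) map `[0, len] → X`. The values of `toFun` outside `[0, len]` are
never used. -/
structure Segment (X : Type*) where
  len : ℝ≥0
  toFun : ℝ≥0 → X

/-- `γ` is a `(lam, k)`-quasi-geodesic segment. -/
def Segment.IsQuasiGeodesic {X : Type*} [MetricSpace X] (lam k : ℝ) (γ : Segment X) : Prop :=
  ∀ s t : ℝ≥0, s ≤ γ.len → t ≤ γ.len →
    lam⁻¹ * |(s : ℝ) - t| - k ≤ dist (γ.toFun s) (γ.toFun t) ∧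
      dist (γ.toFun s) (γ.toFun t) ≤ lam * |(s : ℝ) - t| + k

/-- The data exhibiting a metric space `X` as a `(lam, k, E, C, θ, L)`-coarsely convex space, where
`L` is the system of good quasi-geodesic segments. -/
structure CoarselyConvexSpace (X : Type*) [MetricSpace X] where
  lam : ℝ
  k : ℝ
  E : ℝ
  C : ℝ
  θ : ℝ≥0 → ℝ≥0
  L : Set (Segment X)
  one_le_lam : 1 ≤ lam
  k_nonneg : 0 ≤ k
  one_le_E : 1 ≤ E
  C_nonneg : 0 ≤ C
  θ_mono : Monotone θ
  quasiGeodesic : ∀ γ ∈ L, γ.IsQuasiGeodesic lam k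
  connected : ∀ v w : X, ∃ γ ∈ L, γ.toFun 0 = v ∧ γ.toFun γ.len = w
  convex : ∀ γ ∈ L, ∀ η ∈ L, ∀ t s c : ℝ≥0, t ≤ γ.len → s ≤ η.len → c ≤ 1 →
    dist (γ.toFun (c * t)) (η.toFun (c * s)) ≤
      c * E * dist (γ.toFun t) (η.toFun s) + (1 - c) * E * dist (γ.toFun 0) (η.toFun 0) + C
  param_regular : ∀ γ ∈ L, ∀ η ∈ L, ∀ t s : ℝ≥0, t ≤ γ.len → s ≤ η.len →
    |(t : ℝ) - s| ≤
      θ (nndist (γ.toFun 0) (η.toFun 0) + nndist (γ.toFun t) (η.toFun s))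

namespace CoarselyConvexSpace

variable {X : Type*} [MetricSpace X]

/-- The constant `k₁ = lam + k`. -/
def k₁ (𝓧 : CoarselyConvexSpace X) : ℝ := 𝓧.lam + 𝓧.k

/-- The constant `D = 2 (1 + E) k₁ + C`. -/
def D (𝓧 : CoarselyConvexSpace X) : ℝ := 2 * (1 + 𝓧.E) * 𝓧.k₁ + 𝓧.C

/-! ### The ideal boundary -/

/-- `γ : [0, ∞) → X` is the limit, pointwise on `ℕ`, of a sequence of good segments with the same
starting point whose lengths tend to infinity. -/
def IsApproximatable (𝓧 : CoarselyConvexSpace X) (γ : ℝ≥0 → X) : Prop :=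
  ∃ s : ℕ → Segment X,
    (∀ n, s n ∈ 𝓧.L ∧ (s n).toFun 0 = γ 0) ∧
    Tendsto (fun n => (s n).len) atTop atTop ∧
    ∀ m : ℕ, Tendsto (fun n => (s n).toFun m) atTop (𝓝 (γ m))

/-- The family `L^∞` of good rays. -/
def rays (𝓧 : CoarselyConvexSpace X) : Set (ℝ≥0 → X) :=
  {γ | 𝓧.IsApproximatable γ ∧ ∀ t : ℝ≥0, γ t = γ (⌊t⌋₊ : ℝ≥0)}

/-- The family `L_O^∞` of good rays starting at `O`. -/
def raysFrom (𝓧 : CoarselyConvexSpace X) (O : X) : Set (ℝ≥0 → X) :=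
  {γ | γ ∈ 𝓧.rays ∧ γ 0 = O}

/-- Two rays are equivalent if they stay at bounded distance from each other. -/
def raySetoid (𝓧 : CoarselyConvexSpace X) (O : X) : Setoid (𝓧.raysFrom O) where
  r γ η := ∃ M : ℝ, ∀ t : ℝ≥0, dist (γ.1 t) (η.1 t) ≤ M
  iseqv :=
    { refl := fun _ => ⟨0, fun _ => by simp⟩
      symm := fun ⟨M, h⟩ => ⟨M, fun t => by rw [dist_comm]; exact h t⟩
      trans := fun ⟨M, h⟩ ⟨N, h'⟩ =>
        ⟨M + N, fun t => (dist_triangle _ _ _).trans (add_le_add (h t) (h' t))⟩ }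

/-- The ideal boundary `∂_O X` with respect to the base point `O`. -/
def Boundary (𝓧 : CoarselyConvexSpace X) (O : X) : Type _ := Quotient (𝓧.raySetoid O)

/-- The class in `∂_O X` of a good ray starting at `O`. -/
def Boundary.mk (𝓧 : CoarselyConvexSpace X) {O : X} (γ : 𝓧.raysFrom O) : 𝓧.Boundary O :=
  Quotient.mk (𝓧.raySetoid O) γ

/-! ### The product of curves and of points of `X ∪ ∂_O X` -/

/-- A map into `X` defined on the subset `dom` of `[0, ∞)`; values outside `dom` are never used. -/
structure _root_.Curve (X : Type*) where
  dom : Set ℝ≥0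
  toFun : ℝ≥0 → X

/-- A segment, seen as a curve with domain `[0, len]`. -/
def _root_.Segment.toCurve {X : Type*} (γ : Segment X) : Curve X := ⟨Icc 0 γ.len, γ.toFun⟩

/-- A ray, seen as a curve with domain `[0, ∞)`. -/
def _root_.Curve.ofRay {X : Type*} (γ : ℝ≥0 → X) : Curve X := ⟨univ, γ⟩

/-- The family `L_O` of good segments of length at least `2 θ(0)` starting at `O`. -/
def segmentsFrom (𝓧 : CoarselyConvexSpace X) (O : X) : Set (Segment X) :=
  {γ | γ ∈ 𝓧.L ∧ 2 * 𝓧.θ 0 ≤ γ.len ∧ γ.toFun 0 = O}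

/-- `(γ ∣ η) = sup {t ∈ Dom γ ∩ Dom η : d(γ(t), η(t)) ≤ 2 D + 2}`. -/
noncomputable def curveProd (𝓧 : CoarselyConvexSpace X) (γ η : Curve X) : ℝ≥0∞ :=
  ⨆ t ∈ {t : ℝ≥0 | t ∈ γ.dom ∩ η.dom ∧ dist (γ.toFun t) (η.toFun t) ≤ 2 * 𝓧.D + 2}, (t : ℝ≥0∞)

/-- The set of good curves from `O` to a point of `X ∪ ∂_O X`. -/
def curvesTo (𝓧 : CoarselyConvexSpace X) (O : X) : X ⊕ 𝓧.Boundary O → Set (Curve X)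
  | Sum.inl x => {c | ∃ γ ∈ 𝓧.segmentsFrom O, γ.toFun γ.len = x ∧ c = γ.toCurve}
  | Sum.inr u => {c | ∃ γ : 𝓧.raysFrom O, Boundary.mk 𝓧 γ = u ∧ c = Curve.ofRay γ.1}

/-- The closed ball of radius `2 lam θ(0) + k` about `O`, as a subset of `X ∪ ∂_O X`. -/
def core (𝓧 : CoarselyConvexSpace X) (O : X) : Set (X ⊕ 𝓧.Boundary O) :=
  Sum.inl '' Metric.closedBall O (2 * 𝓧.lam * 𝓧.θ 0 + 𝓧.k)

open Classical in
/-- The product `(x ∣ y)_O` on `X ∪ ∂_O X`. -/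
noncomputable def gprod (𝓧 : CoarselyConvexSpace X) (O : X) (x y : X ⊕ 𝓧.Boundary O) : ℝ≥0∞ :=
  if x ∈ 𝓧.core O ∨ y ∈ 𝓧.core O then 0
  else ⨆ γ ∈ 𝓧.curvesTo O x, ⨆ η ∈ 𝓧.curvesTo O y, 𝓧.curveProd γ η

/-- The basic entourage `V_n` of `X ∪ ∂_O X`. -/
def entourage (𝓧 : CoarselyConvexSpace X) (O : X) (n : ℕ) :
    Set ((X ⊕ 𝓧.Boundary O) × (X ⊕ 𝓧.Boundary O)) :=
  {p | (n : ℝ≥0∞) < 𝓧.gprod O p.1 p.2} ∪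
    {p | ∃ x y : X, p = (Sum.inl x, Sum.inl y) ∧ dist x y < (n : ℝ)⁻¹}

/-- Convergence of a sequence in `X ∪ ∂_O X`, the sets `V_n(z)`, `n ≥ 1`, being a fundamental system
of neighbourhoods of `z`. -/
def ConvergesTo (𝓧 : CoarselyConvexSpace X) (O : X) (z : ℕ → X ⊕ 𝓧.Boundary O)
    (w : X ⊕ 𝓧.Boundary O) : Prop :=
  ∀ n : ℕ, 1 ≤ n → ∀ᶠ i in atTop, (w, z i) ∈ 𝓧.entourage O n

/-- `m` is a metric on `∂_O X` such that `K (u ∣ v)^(-ε) ≤ m(u, v) ≤ (u ∣ v)^(-ε)` for some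
constant `0 < K < 1` (with `∞^(-ε) = 0`). -/
def IsBoundaryMetric (𝓧 : CoarselyConvexSpace X) (O : X) (ε : ℝ)
    (m : MetricSpace (𝓧.Boundary O)) : Prop :=
  ∃ K : ℝ≥0, 0 < K ∧ K < 1 ∧ ∀ u v : 𝓧.Boundary O,
    (K : ℝ≥0∞) * 𝓧.gprod O (Sum.inr u) (Sum.inr v) ^ (-ε) ≤ edist u v ∧
      edist u v ≤ 𝓧.gprod O (Sum.inr u) (Sum.inr v) ^ (-ε)

end CoarselyConvexSpace

/-! ### Maps between coarsely convex spaces -/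

/-- `f` is an `(A, B)`-large scale Lipschitz map for some `A ≥ 1`, `B ≥ 0`. -/
def IsLargeScaleLipschitz {X Y : Type*} [MetricSpace X] [MetricSpace Y] (f : X → Y) : Prop :=
  ∃ A B : ℝ, 1 ≤ A ∧ 0 ≤ B ∧ ∀ x x' : X, dist (f x) (f x') ≤ A * dist x x' + B

/-- `σ` is a `τ`-rough contraction for some `τ ≥ 0`. -/
def IsRoughContraction (σ : ℝ≥0 → ℝ≥0) : Prop :=
  ∃ τ : ℝ, 0 ≤ τ ∧ σ 0 = 0 ∧ Tendsto σ atTop atTop ∧ (∀ t, σ t ≤ t) ∧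
    (∀ t s : ℝ≥0, |(σ t : ℝ) - σ s| ≤ |(t : ℝ) - s| + τ) ∧ Monotone σ

/-- Rough-isometric contractions. -/
def IsRoughIsometricContraction (σ : ℝ≥0 → ℝ≥0) : Prop :=
  IsRoughContraction σ ∧ ∃ A B : ℝ, 0 < A ∧ 0 ≤ B ∧
    ∀ s t : ℝ≥0, A * |(t : ℝ) - s| - B ≤ |(σ t : ℝ) - σ s|

namespace CoarselyConvexSpace

variable {X Y : Type*} [MetricSpace X] [MetricSpace Y]

/-- `f` is a visual map with respect to the base points `a` and `b`. -/
def IsVisual (𝓧 : CoarselyConvexSpace X) (𝓨 : CoarselyConvexSpace Y) (a : X) (b : Y)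
    (f : X → Y) : Prop :=
  IsLargeScaleLipschitz f ∧ ∀ x y : ℕ → X,
    Tendsto (fun n => 𝓧.gprod a (Sum.inl (x n)) (Sum.inl (y n))) atTop (𝓝 ⊤) →
      Tendsto (fun n => 𝓨.gprod b (Sum.inl (f (x n))) (Sum.inl (f (y n)))) atTop (𝓝 ⊤)

/-- `F` is the map `∂f` induced by `f`: for every representative `γ` of a boundary point `u`,
`F(u)` is the limit of `f(γ(n))` in `Y ∪ ∂_b Y`. -/
def IsInducedMap (𝓧 : CoarselyConvexSpace X) (𝓨 : CoarselyConvexSpace Y) (a : X) (b : Y)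
    (f : X → Y) (F : 𝓧.Boundary a → 𝓨.Boundary b) : Prop :=
  ∀ γ : 𝓧.raysFrom a,
    𝓨.ConvergesTo b (fun n : ℕ => Sum.inl (f (γ.1 n))) (Sum.inr (F (Boundary.mk 𝓧 γ)))

/-- `f` is `σ`-`L_a`-radial. -/
def IsRadial (𝓧 : CoarselyConvexSpace X) (a : X) (σ : ℝ≥0 → ℝ≥0) (f : X → Y) : Prop :=
  ∀ γ ∈ 𝓧.segmentsFrom a, ∀ t : ℝ≥0, t ≤ γ.len → (σ t : ℝ) ≤ dist (f (γ.toFun t)) (f a)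

/-- `f` is `ρ`-`H`-`L_a`-`L_b`-equivariant. -/
def IsEquivariant (𝓧 : CoarselyConvexSpace X) (𝓨 : CoarselyConvexSpace Y) (a : X) (b : Y)
    (ρ : ℝ≥0 → ℝ≥0) (H : ℝ) (f : X → Y) : Prop :=
  f a = b ∧ ∀ γ ∈ 𝓧.segmentsFrom a, ∀ η ∈ 𝓨.segmentsFrom b,
    η.toFun η.len = f (γ.toFun γ.len) →
      ∀ t : ℝ≥0, t ≤ γ.len → ρ t ≤ η.len → dist (f (γ.toFun t)) (η.toFun (ρ t)) < H

end CoarselyConvexSpace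

namespace CoarselyConvexSpace

variable {X : Type*} [MetricSpace X] (𝓧 : CoarselyConvexSpace X) {O : X}

/-! ### Elementary constants -/

/-! Good segments and good rays from a common base point obey one contraction estimate,
`Shadowed.dist_mul_le`: shrinking times by r multiplies distances by at most rE, up to an additive
D. Curves at distance at most M at time T are therefore within 2D + 2 at a fixed fraction of T. So,
up to a multiplicative constant, the product does not depend on the distance threshold or on the
curves chosen.

This makes the product a quasi-ultrametric up to inversion (`exists_mul_min_gprod_le`). For small ε
the quasi-ultrametric constant of its power -ε is at most 2, and a chain construction turns that
power into a metric.

For the map, approximate a ray γ by good segments. Radiality sends the images of their endpoints to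
infinity. Good segments in Y from b to these images subconverge to a ray η by properness, and
equivariance passes to the limit: f ∘ γ stays within a uniform distance of η ∘ ρ
(`exists_ray_dist_le`). The class of η is the value of ∂f. If two rays are close at time t, their
image rays are boundedly close at time ρ(t), and ρ(t) grows at least linearly. Hence (u ∣ v) ≤ κ (∂f
u ∣ ∂f v) (`exists_gprod_le_mul_gprod`), and the power -ε turns this into the Lipschitz bound. The
same comparison with segments in place of rays gives visuality. -/

theorem k₁_nonneg : 0 ≤ 𝓧.k₁ := by
  have := 𝓧.one_le_lam
  have := 𝓧.k_nonneg
  unfold k₁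
  linarith

theorem E_nonneg : 0 ≤ 𝓧.E := zero_le_one.trans 𝓧.one_le_E

theorem lam_pos : 0 < 𝓧.lam := zero_lt_one.trans_le 𝓧.one_le_lam

theorem D_nonneg : 0 ≤ 𝓧.D := by
  have h1 := 𝓧.k₁_nonneg
  have h2 := 𝓧.E_nonneg
  have h3 := 𝓧.C_nonneg
  unfold D
  positivity

/-! ### Curves shadowed by good segments -/

/-- A curve with an initial interval as domain is shadowed from `O` if on every `[0, T]` in its
domain it is within `k₁ + δ` of a good segment starting at `O`, for every `δ > 0`. -/
structure Shadowed (O : X) (c : Curve X) : Prop where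
  mem_of_le : ∀ T ∈ c.dom, ∀ t ≤ T, t ∈ c.dom
  exists_segment : ∀ T ∈ c.dom, ∀ δ : ℝ, 0 < δ → ∃ γ ∈ 𝓧.L, γ.toFun 0 = O ∧ T ≤ γ.len ∧
    ∀ t ≤ T, dist (γ.toFun t) (c.toFun t) ≤ 𝓧.k₁ + δ

variable {𝓧}

theorem shadowed_toCurve {γ : Segment X} (hγ : γ ∈ 𝓧.L) (h0 : γ.toFun 0 = O) :
    𝓧.Shadowed O γ.toCurve where
  mem_of_le T hT t ht := ⟨zero_le, ht.trans hT.2⟩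
  exists_segment T hT δ hδ := ⟨γ, hγ, h0, hT.2, fun t _ => by
    have := 𝓧.k₁_nonneg
    simp only [Segment.toCurve, dist_self]
    linarith⟩

theorem dist_le_k₁ {γ : Segment X} (hγ : γ ∈ 𝓧.L) {t : ℝ≥0} (ht : t ≤ γ.len) :
    dist (γ.toFun t) (γ.toFun (⌊t⌋₊ : ℝ≥0)) ≤ 𝓧.k₁ := by
  have hfl : ((⌊t⌋₊ : ℝ≥0)) ≤ t := Nat.floor_le zero_le
  have hlt : t < (⌊t⌋₊ : ℝ≥0) + 1 := Nat.lt_floor_add_one t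
  have h1 : ((⌊t⌋₊ : ℝ≥0) : ℝ) ≤ t := hfl
  have h2 : (t : ℝ) < ((⌊t⌋₊ : ℝ≥0) : ℝ) + 1 := by exact_mod_cast hlt
  have h := (𝓧.quasiGeodesic γ hγ t (⌊t⌋₊ : ℝ≥0) ht (hfl.trans ht)).2
  rw [abs_of_nonneg (by linarith)] at h
  have := 𝓧.lam_pos
  unfold k₁
  nlinarith

/-- On bounded sets a ray is eventually close to the segments approximating it. -/
theorem eventually_dist_le {s : ℕ → Segment X} {γ : ℝ≥0 → X} (hs : ∀ n, s n ∈ 𝓧.L)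
    (hlen : Tendsto (fun n => (s n).len) atTop atTop)
    (hlim : ∀ m : ℕ, Tendsto (fun n => (s n).toFun m) atTop (𝓝 (γ m)))
    (hfl : ∀ t : ℝ≥0, γ t = γ (⌊t⌋₊ : ℝ≥0)) (T : ℝ≥0) {δ : ℝ} (hδ : 0 < δ) :
    ∀ᶠ n in atTop, ∀ t ≤ T, dist ((s n).toFun t) (γ t) ≤ 𝓧.k₁ + δ := by
  have h1 : ∀ᶠ n in atTop, ∀ m ∈ Finset.range (⌊T⌋₊ + 1), dist ((s n).toFun m) (γ m) < δ := by
    rw [Filter.eventually_all_finset]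
    exact fun m _ => (Metric.tendsto_nhds.1 (hlim m)) δ hδ
  filter_upwards [h1, hlen.eventually_ge_atTop T] with n hn hT t ht
  have hm := hn ⌊t⌋₊ (Finset.mem_range.2 (Nat.lt_succ_of_le (Nat.floor_le_floor ht)))
  rw [hfl t]
  linarith [dist_triangle ((s n).toFun t) ((s n).toFun (⌊t⌋₊ : ℝ≥0)) (γ (⌊t⌋₊ : ℝ≥0)),
    dist_le_k₁ (hs n) (ht.trans hT)]

theorem shadowed_ofRay {γ : ℝ≥0 → X} (hγ : γ ∈ 𝓧.raysFrom O) :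
    𝓧.Shadowed O (Curve.ofRay γ) where
  mem_of_le _ _ _ _ := mem_univ _
  exists_segment T _ δ hδ := by
    obtain ⟨⟨⟨s, hs, hlen, hlim⟩, hfl⟩, h0⟩ := hγ
    obtain ⟨n, hn, hT⟩ := ((eventually_dist_le (fun n => (hs n).1) hlen hlim hfl T hδ).and
      (hlen.eventually_ge_atTop T)).exists
    exact ⟨s n, (hs n).1, (hs n).2.trans h0, hT, hn⟩

namespace Shadowed

variable {c c' : Curve X}

/-- Convexity is applied to the shadowing segments, whose common origin removes the (1 - c)E term.
Replacing curves by segments costs 2(k₁ + δ) at the small times and at most E times as much at the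
large ones, which with C is exactly D as δ → 0. -/
theorem dist_mul_le (hc : 𝓧.Shadowed O c) (hc' : 𝓧.Shadowed O c') {T S r : ℝ≥0}
    (hT : T ∈ c.dom) (hS : S ∈ c'.dom) (hr : r ≤ 1) :
    dist (c.toFun (r * T)) (c'.toFun (r * S)) ≤
      r * 𝓧.E * dist (c.toFun T) (c'.toFun S) + 𝓧.D := by
  refine le_of_forall_pos_le_add fun e he => ?_
  have hE := 𝓧.E_nonneg
  obtain ⟨δ, hδ, hδe⟩ : ∃ δ : ℝ, 0 < δ ∧ 2 * (1 + 𝓧.E) * δ ≤ e :=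
    ⟨e / (2 * (1 + 𝓧.E)), by positivity, by field_simp; rfl⟩
  obtain ⟨γ, hγ, h0, hTγ, hγc⟩ := hc.exists_segment T hT δ hδ
  obtain ⟨η, hη, h0', hSη, hηc⟩ := hc'.exists_segment S hS δ hδ
  have hconv := 𝓧.convex γ hγ η hη T S r hTγ hSη hr
  rw [h0, h0', dist_self, mul_zero, add_zero] at hconv
  have h1 := hγc (r * T) (mul_le_of_le_one_left zero_le hr)
  have h2 := hηc (r * S) (mul_le_of_le_one_left zero_le hr)
  have h3 := hγc T le_rfl
  have h4 := hηc S le_rfl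
  rw [dist_comm] at h1
  rw [dist_comm] at h4
  have h5 := dist_triangle4 (c.toFun (r * T)) (γ.toFun (r * T)) (η.toFun (r * S))
    (c'.toFun (r * S))
  have h6 := dist_triangle4 (γ.toFun T) (c.toFun T) (c'.toFun S) (η.toFun S)
  have hr' : (r : ℝ) ≤ 1 := hr
  have h7 : r * 𝓧.E * dist (γ.toFun T) (η.toFun S) ≤
      r * 𝓧.E * (dist (c.toFun T) (c'.toFun S) + 2 * (𝓧.k₁ + δ)) :=
    mul_le_mul_of_nonneg_left (by linarith) (by positivity)
  have h8 : r * 𝓧.E * (2 * (𝓧.k₁ + δ)) ≤ 𝓧.E * (2 * (𝓧.k₁ + δ)) := by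
    have := 𝓧.k₁_nonneg
    exact mul_le_mul_of_nonneg_right (mul_le_of_le_one_left hE hr') (by positivity)
  have hD : 𝓧.D = 2 * (1 + 𝓧.E) * 𝓧.k₁ + 𝓧.C := rfl
  linarith

/-- At earlier times two shadowed curves are at most a bounded amount further apart. -/
theorem dist_le_of_le (hc : 𝓧.Shadowed O c) (hc' : 𝓧.Shadowed O c') {t T : ℝ≥0} {M : ℝ}
    (hT : T ∈ c.dom) (hT' : T ∈ c'.dom) (ht : t ≤ T)
    (hM : dist (c.toFun T) (c'.toFun T) ≤ M) :
    dist (c.toFun t) (c'.toFun t) ≤ 𝓧.E * M + 𝓧.D := by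
  -- The ratio t / T below is meaningful only for T ≠ 0; for T = 0 the claim follows from E ≥ 1.
  rcases eq_or_ne T 0 with rfl | hT0
  · obtain rfl : t = 0 := le_antisymm ht zero_le
    have h1 := 𝓧.one_le_E
    have h2 := 𝓧.D_nonneg
    have h3 := dist_nonneg.trans hM
    nlinarith
  · have hr : t / T ≤ 1 := div_le_one_of_le₀ ht zero_le
    have h := hc.dist_mul_le hc' hT hT' hr
    rw [div_mul_cancel₀ _ hT0] at h
    refine h.trans (add_le_add_left ?_ _)
    have hE := 𝓧.E_nonneg
    have hr' : ((t / T : ℝ≥0) : ℝ) ≤ 1 := hr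
    exact mul_le_mul (mul_le_of_le_one_left hE hr') hM dist_nonneg hE

/-- Parameter regularity of the shadowing segments with δ = 1; passing to them adds 2(k₁ + 1) to the
distance. -/
theorem abs_sub_le (hc : 𝓧.Shadowed O c) (hc' : 𝓧.Shadowed O c') {T S : ℝ≥0} {M : ℝ}
    (hT : T ∈ c.dom) (hS : S ∈ c'.dom) (hM : dist (c.toFun T) (c'.toFun S) ≤ M) :
    |(T : ℝ) - S| ≤ 𝓧.θ (Real.toNNReal (M + 2 * (𝓧.k₁ + 1))) := by
  obtain ⟨γ, hγ, h0, hTγ, hγc⟩ := hc.exists_segment T hT 1 one_pos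
  obtain ⟨η, hη, h0', hSη, hηc⟩ := hc'.exists_segment S hS 1 one_pos
  refine (𝓧.param_regular γ hγ η hη T S hTγ hSη).trans ?_
  have h3 := hγc T le_rfl
  have h4 := hηc S le_rfl
  rw [dist_comm] at h4
  have h6 := dist_triangle4 (γ.toFun T) (c.toFun T) (c'.toFun S) (η.toFun S)
  rw [h0, h0', nndist_self, zero_add]
  refine NNReal.coe_le_coe.2 (𝓧.θ_mono (NNReal.le_toNNReal_of_coe_le ?_))
  rw [coe_nndist]
  linarith

theorem dist_le_lam_mul (hc : 𝓧.Shadowed O c) {t T : ℝ≥0} (hT : T ∈ c.dom) (ht : t ≤ T) :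
    dist (c.toFun t) (c.toFun T) ≤ 𝓧.lam * |(t : ℝ) - T| + (𝓧.k + 2 * (𝓧.k₁ + 1)) := by
  obtain ⟨γ, hγ, h0, hTγ, hγc⟩ := hc.exists_segment T hT 1 one_pos
  have h1 := hγc t ht
  have h2 := hγc T le_rfl
  rw [dist_comm] at h1
  linarith [dist_triangle4 (c.toFun t) (γ.toFun t) (γ.toFun T) (c.toFun T),
    (𝓧.quasiGeodesic γ hγ t T (ht.trans hTγ) hTγ).2]

/-- Curves that are close at possibly different times are close at the earlier of these times. -/
theorem dist_min_le (hc : 𝓧.Shadowed O c) (hc' : 𝓧.Shadowed O c') {T S : ℝ≥0} {M : ℝ}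
    (hT : T ∈ c.dom) (hS : S ∈ c'.dom) (hM : dist (c.toFun T) (c'.toFun S) ≤ M) :
    dist (c.toFun (min T S)) (c'.toFun (min T S)) ≤
      M + 𝓧.lam * 𝓧.θ (Real.toNNReal (M + 2 * (𝓧.k₁ + 1))) + (𝓧.k + 2 * (𝓧.k₁ + 1)) := by
  have h := hc.abs_sub_le hc' hT hS hM
  have hl := mul_le_mul_of_nonneg_left h 𝓧.lam_pos.le
  rcases le_total T S with hTS | hTS
  · rw [min_eq_left hTS]
    have h1 := hc'.dist_le_lam_mul hS hTS
    rw [dist_comm] at h1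
    linarith [dist_triangle (c.toFun T) (c'.toFun S) (c'.toFun T)]
  · rw [min_eq_right hTS]
    have h1 := hc.dist_le_lam_mul hT hTS
    rw [abs_sub_comm] at h1
    linarith [dist_triangle (c.toFun S) (c.toFun T) (c'.toFun S)]

end Shadowed

/-! ### Lower bounds for products -/

variable (𝓧) in
/-- The factor by which times have to be shrunk in order to bring curves from distance `M` to
distance `2 D + 2`. -/
noncomputable def shrink (M : ℝ) : ℝ≥0 := (Real.toNNReal (𝓧.E * M) + 1)⁻¹

theorem shrink_pos (M : ℝ) : 0 < 𝓧.shrink M := by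
  unfold shrink
  positivity

theorem le_curveProd {c c' : Curve X} {t : ℝ≥0} (ht : t ∈ c.dom) (ht' : t ∈ c'.dom)
    (h : dist (c.toFun t) (c'.toFun t) ≤ 2 * 𝓧.D + 2) : (t : ℝ≥0∞) ≤ 𝓧.curveProd c c' :=
  le_iSup₂_of_le t ⟨⟨ht, ht'⟩, h⟩ le_rfl

/-- The factor `shrink M` makes the term rEM at most 1, so the distance at the shrunk time is at
most 1 + D ≤ 2D + 2. This converts any bound M into a lower bound for the product. -/
theorem Shadowed.shrink_mul_le_curveProd {c c' : Curve X} (hc : 𝓧.Shadowed O c)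
    (hc' : 𝓧.Shadowed O c') {T : ℝ≥0} {M : ℝ} (hT : T ∈ c.dom) (hT' : T ∈ c'.dom)
    (hM : dist (c.toFun T) (c'.toFun T) ≤ M) :
    ((𝓧.shrink M * T : ℝ≥0) : ℝ≥0∞) ≤ 𝓧.curveProd c c' := by
  have hr : 𝓧.shrink M ≤ 1 := inv_le_one_of_one_le₀ (by simp)
  have hle : 𝓧.shrink M * T ≤ T := mul_le_of_le_one_left zero_le hr
  refine le_curveProd (hc.mem_of_le T hT _ hle) (hc'.mem_of_le T hT' _ hle) ?_
  have hE := 𝓧.E_nonneg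
  have hM0 := dist_nonneg.trans hM
  have h1 : (𝓧.shrink M : ℝ) * 𝓧.E * dist (c.toFun T) (c'.toFun T) ≤ 1 := by
    have h2 : (𝓧.shrink M : ℝ) * 𝓧.E * dist (c.toFun T) (c'.toFun T) ≤
        (𝓧.shrink M : ℝ) * 𝓧.E * M := mul_le_mul_of_nonneg_left hM (by positivity)
    refine h2.trans ?_
    rw [shrink, NNReal.coe_inv, NNReal.coe_add, Real.coe_toNNReal _ (by positivity),
      NNReal.coe_one, mul_assoc, inv_mul_le_one₀ (by positivity)]
    linarith
  linarith [hc.dist_mul_le hc' hT hT' hr, 𝓧.D_nonneg]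

theorem curveProd_comm (c c' : Curve X) : 𝓧.curveProd c c' = 𝓧.curveProd c' c := by
  unfold curveProd
  simp only [inter_comm c.dom, dist_comm]

theorem gprod_comm (x y : X ⊕ 𝓧.Boundary O) : 𝓧.gprod O x y = 𝓧.gprod O y x := by
  unfold gprod
  rw [iSup₂_comm]
  simp only [curveProd_comm, or_comm]
  split_ifs <;> first | rfl | (exfalso; tauto)

theorem curveProd_le_gprod {x y : X ⊕ 𝓧.Boundary O} (hx : x ∉ 𝓧.core O) (hy : y ∉ 𝓧.core O)
    {c c' : Curve X} (hc : c ∈ 𝓧.curvesTo O x) (hc' : c' ∈ 𝓧.curvesTo O y) :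
    𝓧.curveProd c c' ≤ 𝓧.gprod O x y := by
  rw [gprod, if_neg (by tauto)]
  exact le_iSup₂_of_le c hc (le_iSup₂_of_le c' hc' le_rfl)

theorem exists_of_lt_gprod {x y : X ⊕ 𝓧.Boundary O} {N : ℝ≥0∞} (h : N < 𝓧.gprod O x y) :
    x ∉ 𝓧.core O ∧ y ∉ 𝓧.core O ∧ ∃ c ∈ 𝓧.curvesTo O x, ∃ c' ∈ 𝓧.curvesTo O y, ∃ t : ℝ≥0,
      t ∈ c.dom ∧ t ∈ c'.dom ∧ N < t ∧ dist (c.toFun t) (c'.toFun t) ≤ 2 * 𝓧.D + 2 := by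
  unfold gprod at h
  split_ifs at h with hcore
  · simp at h
  · simp only [curveProd, lt_iSup_iff] at h
    obtain ⟨c, hc, c', hc', t, ⟨⟨ht, ht'⟩, hd⟩, hN⟩ := h
    push Not at hcore
    exact ⟨hcore.1, hcore.2, c, hc, c', hc', t, ht, ht', hN, hd⟩

theorem shadowed_of_mem_curvesTo {x : X ⊕ 𝓧.Boundary O} {c : Curve X}
    (hc : c ∈ 𝓧.curvesTo O x) : 𝓧.Shadowed O c := by
  rcases x with x | u
  · obtain ⟨γ, hγ, -, rfl⟩ := hc
    exact shadowed_toCurve hγ.1 hγ.2.2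
  · obtain ⟨γ, -, rfl⟩ := hc
    exact shadowed_ofRay γ.2

/-- Equivalent rays are at distance at most `D`. -/
theorem dist_le_D_of_mk_eq {γ η : 𝓧.raysFrom O} (h : Boundary.mk 𝓧 γ = Boundary.mk 𝓧 η)
    (t : ℝ≥0) : dist (γ.1 t) (η.1 t) ≤ 𝓧.D := by
  obtain ⟨M, hM⟩ : ∃ M : ℝ, ∀ t : ℝ≥0, dist (γ.1 t) (η.1 t) ≤ M := Quotient.exact h
  have hM0 := dist_nonneg.trans (hM 0)
  refine le_of_forall_pos_le_add fun e he => ?_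
  obtain ⟨n, hn⟩ := exists_nat_gt (𝓧.E * M / e)
  have hE := 𝓧.E_nonneg
  have hn0 : (0 : ℝ) < n := lt_of_le_of_lt (by positivity) hn
  have hn0' : (n : ℝ≥0) ≠ 0 := by
    rintro h
    simp [Nat.cast_eq_zero.1 h] at hn0
  have hn1 : (1 : ℝ≥0) ≤ n := by
    have : n ≠ 0 := by rintro rfl; simp at hn0
    exact_mod_cast Nat.one_le_iff_ne_zero.2 this
  -- Contract from the far time nt back to t: the bound M enters only as EM/n, which is below e.
  have hd := (shadowed_ofRay γ.2).dist_mul_le (shadowed_ofRay η.2) (T := n * t) (S := n * t)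
    (r := (n : ℝ≥0)⁻¹) (mem_univ _) (mem_univ _) (inv_le_one_of_one_le₀ hn1)
  rw [inv_mul_cancel_left₀ hn0'] at hd
  simp only [Curve.ofRay, NNReal.coe_inv, NNReal.coe_natCast] at hd
  have h1 : (n : ℝ)⁻¹ * 𝓧.E * dist (γ.1 (n * t)) (η.1 (n * t)) ≤ (n : ℝ)⁻¹ * 𝓧.E * M :=
    mul_le_mul_of_nonneg_left (hM _) (by positivity)
  have h2 : (n : ℝ)⁻¹ * 𝓧.E * M ≤ e := by
    rw [mul_assoc, inv_mul_le_iff₀ hn0]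
    exact ((div_lt_iff₀ he).1 hn).le
  linarith

/-- Good curves from `O` to the same point of `X ∪ ∂_O X` stay uniformly close. -/
theorem exists_dist_le_of_mem_curvesTo (𝓧 : CoarselyConvexSpace X) (O : X) :
    ∃ M : ℝ, ∀ x : X ⊕ 𝓧.Boundary O, ∀ c ∈ 𝓧.curvesTo O x, ∀ c' ∈ 𝓧.curvesTo O x,
      ∀ t ∈ c.dom, t ∈ c'.dom → dist (c.toFun t) (c'.toFun t) ≤ M := by
  obtain ⟨M, hM⟩ : ∃ M : ℝ, M = 0 + 𝓧.lam * 𝓧.θ (Real.toNNReal (0 + 2 * (𝓧.k₁ + 1))) +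
    (𝓧.k + 2 * (𝓧.k₁ + 1)) := ⟨_, rfl⟩
  refine ⟨max 𝓧.D (𝓧.E * M + 𝓧.D), ?_⟩
  rintro (x | u) c hc c' hc' t ht ht'
  · refine le_trans ?_ (le_max_right _ _)
    have hs := shadowed_of_mem_curvesTo hc
    have hs' := shadowed_of_mem_curvesTo hc'
    obtain ⟨γ, hγ, hx, rfl⟩ := hc
    obtain ⟨η, hη, hx', rfl⟩ := hc'
    -- Segments to the same point may differ in length, so they are compared at the shorter length,
    -- which dominates every common time.
    have hd := hs.dist_min_le hs' (T := γ.len) (S := η.len) (M := 0) ⟨zero_le, le_rfl⟩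
      ⟨zero_le, le_rfl⟩ (by simp [Segment.toCurve, hx, hx'])
    rw [← hM] at hd
    exact hs.dist_le_of_le hs' ⟨zero_le, min_le_left _ _⟩ ⟨zero_le, min_le_right _ _⟩
      (le_min ht.2 ht'.2) hd
  · refine le_trans ?_ (le_max_left _ _)
    obtain ⟨γ, rfl, rfl⟩ := hc
    obtain ⟨η, hη, rfl⟩ := hc'
    exact dist_le_D_of_mk_eq hη.symm t

/-- The product is a quasi-ultrametric, up to inversion. -/
theorem exists_mul_min_gprod_le (𝓧 : CoarselyConvexSpace X) (O : X) :
    ∃ κ : ℝ≥0, 0 < κ ∧ ∀ x y z : X ⊕ 𝓧.Boundary O,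
      κ * min (𝓧.gprod O x y) (𝓧.gprod O y z) ≤ 𝓧.gprod O x z := by
  obtain ⟨M, hM⟩ := exists_dist_le_of_mem_curvesTo 𝓧 O
  obtain ⟨R, hR⟩ : ∃ R : ℝ, R = 𝓧.E * (2 * 𝓧.D + 2) + 𝓧.D := ⟨_, rfl⟩
  -- At any time N below both products, the path from the curve to x to the curve to z passes
  -- through two good curves to y: R for each closeness carried back to N, M between the two curves
  -- to y.
  refine ⟨𝓧.shrink (R + M + R), shrink_pos _, fun x y z => ?_⟩
  have hκ : (𝓧.shrink (R + M + R) : ℝ≥0∞) ≠ 0 := by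
    exact_mod_cast (shrink_pos (𝓧 := 𝓧) (R + M + R)).ne'
  rw [mul_comm, ← ENNReal.le_div_iff_mul_le (.inl hκ) (.inl ENNReal.coe_ne_top)]
  refine ENNReal.le_of_forall_nnreal_lt fun N hN => ?_
  rw [ENNReal.le_div_iff_mul_le (.inl hκ) (.inl ENNReal.coe_ne_top), mul_comm]
  obtain ⟨hx, -, c, hc, c₁, hc₁, t, ht, ht₁, hNt, hd⟩ :=
    exists_of_lt_gprod (hN.trans_le (min_le_left _ _))
  obtain ⟨-, hz, c₂, hc₂, c', hc', s, hs₂, hs', hNs, hd'⟩ :=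
    exists_of_lt_gprod (hN.trans_le (min_le_right _ _))
  have sc := shadowed_of_mem_curvesTo hc
  have sc₁ := shadowed_of_mem_curvesTo hc₁
  have sc₂ := shadowed_of_mem_curvesTo hc₂
  have sc' := shadowed_of_mem_curvesTo hc'
  have hNt' : N ≤ t := (ENNReal.coe_lt_coe.1 hNt).le
  have hNs' : N ≤ s := (ENNReal.coe_lt_coe.1 hNs).le
  have h1 := sc.dist_le_of_le sc₁ ht ht₁ hNt' hd
  have h2 := sc₂.dist_le_of_le sc' hs₂ hs' hNs' hd'
  have h3 := hM y c₁ hc₁ c₂ hc₂ N (sc₁.mem_of_le t ht₁ N hNt') (sc₂.mem_of_le s hs₂ N hNs')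
  rw [← hR] at h1 h2
  refine le_trans ?_ (curveProd_le_gprod hx hz hc hc')
  exact_mod_cast sc.shrink_mul_le_curveProd sc' (sc.mem_of_le t ht N hNt')
    (sc'.mem_of_le s hs' N hNs') (by
      linarith [dist_triangle4 (c.toFun N) (c₁.toFun N) (c₂.toFun N) (c'.toFun N)])

/-! ### Products of boundary points -/

theorem inr_notMem_core (u : 𝓧.Boundary O) : Sum.inr u ∉ 𝓧.core O := by
  simp [core]

theorem curveProd_ofRay_le_gprod (γ η : 𝓧.raysFrom O) :
    𝓧.curveProd (Curve.ofRay γ.1) (Curve.ofRay η.1) ≤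
      𝓧.gprod O (Sum.inr (Boundary.mk 𝓧 γ)) (Sum.inr (Boundary.mk 𝓧 η)) :=
  curveProd_le_gprod (inr_notMem_core _) (inr_notMem_core _) ⟨γ, rfl, rfl⟩ ⟨η, rfl, rfl⟩

theorem Boundary.exists_rep (u : 𝓧.Boundary O) : ∃ γ : 𝓧.raysFrom O, Boundary.mk 𝓧 γ = u :=
  Quotient.exists_rep u

/-- Rays are constant on [0, 1), hence equal to O there. The bound keeps negative powers finite and
later absorbs additive constants into multiplicative ones. -/
theorem one_le_gprod (u v : 𝓧.Boundary O) : 1 ≤ 𝓧.gprod O (Sum.inr u) (Sum.inr v) := by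
  obtain ⟨γ, rfl⟩ := u.exists_rep
  obtain ⟨η, rfl⟩ := v.exists_rep
  refine le_trans ?_ (curveProd_ofRay_le_gprod γ η)
  refine le_of_forall_lt fun a ha => ?_
  obtain ⟨t, hat, ht1⟩ := ENNReal.lt_iff_exists_nnreal_btwn.1 ha
  refine hat.trans_le (le_curveProd (mem_univ _) (mem_univ _) ?_)
  have ht : ⌊t⌋₊ = 0 := Nat.floor_eq_zero.2 (by exact_mod_cast ht1)
  have h1 : γ.1 t = O := by rw [γ.2.1.2 t, ht, Nat.cast_zero, γ.2.2]
  have h2 : η.1 t = O := by rw [η.2.1.2 t, ht, Nat.cast_zero, η.2.2]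
  have := 𝓧.D_nonneg
  simp only [Curve.ofRay, h1, h2, dist_self]
  positivity

theorem gprod_self (u : 𝓧.Boundary O) : 𝓧.gprod O (Sum.inr u) (Sum.inr u) = ⊤ := by
  obtain ⟨γ, rfl⟩ := u.exists_rep
  refine eq_top_iff.2 (le_trans ?_ (curveProd_ofRay_le_gprod γ γ))
  refine ENNReal.le_of_forall_nnreal_lt fun t _ => le_curveProd (mem_univ _) (mem_univ _) ?_
  have := 𝓧.D_nonneg
  rw [dist_self]
  positivity

theorem eq_of_gprod_eq_top {u v : 𝓧.Boundary O}
    (h : 𝓧.gprod O (Sum.inr u) (Sum.inr v) = ⊤) : u = v := by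
  obtain ⟨γ, rfl⟩ := u.exists_rep
  obtain ⟨η, rfl⟩ := v.exists_rep
  refine Quotient.sound ⟨𝓧.D + (𝓧.E * (2 * 𝓧.D + 2) + 𝓧.D) + 𝓧.D, fun t => ?_⟩
  obtain ⟨-, -, c, hc, c', hc', T, hT, hT', htT, hd⟩ :=
    exists_of_lt_gprod (h ▸ ENNReal.coe_lt_top : (t : ℝ≥0∞) < _)
  have h1 := (shadowed_of_mem_curvesTo hc).dist_le_of_le (shadowed_of_mem_curvesTo hc') hT hT'
    (ENNReal.coe_lt_coe.1 htT).le hd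
  obtain ⟨γ', hγ', rfl⟩ := hc
  obtain ⟨η', hη', rfl⟩ := hc'
  exact (dist_triangle4 _ _ _ _).trans (add_le_add (add_le_add (dist_le_D_of_mk_eq hγ'.symm t) h1)
    (dist_le_D_of_mk_eq hη' t))

end CoarselyConvexSpace

namespace CoarselyConvexSpace

variable {X : Type*} [MetricSpace X] {𝓧 : CoarselyConvexSpace X} {O : X}

/-! ### Existence of the metrics on the boundary -/

/-- The four-point form is what the chain construction of a metric requires; `min κ 1` ensures that
the first entry of the minimum is not enlarged. -/
theorem exists_mul_min_min_gprod_le (𝓧 : CoarselyConvexSpace X) (O : X) :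
    ∃ κ : ℝ≥0, 0 < κ ∧ ∀ x y z w : X ⊕ 𝓧.Boundary O,
      κ * min (𝓧.gprod O x y) (min (𝓧.gprod O y z) (𝓧.gprod O z w)) ≤ 𝓧.gprod O x w := by
  obtain ⟨κ, hκ, h⟩ := exists_mul_min_gprod_le 𝓧 O
  have hle : ((min κ 1 : ℝ≥0) : ℝ≥0∞) ≤ κ := by exact_mod_cast min_le_left _ _
  have hle1 : ((min κ 1 : ℝ≥0) : ℝ≥0∞) ≤ 1 := by exact_mod_cast min_le_right _ _
  refine ⟨κ * min κ 1, by positivity, fun x y z w => le_trans ?_ (h x y w)⟩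
  rw [ENNReal.coe_mul, mul_assoc]
  refine mul_le_mul_right (le_min ?_ (le_trans ?_ (h y z w))) _
  · exact (mul_le_of_le_one_left zero_le hle1).trans (min_le_left _ _)
  · exact mul_le_mul' hle (min_le_right _ _)

theorem _root_.ENNReal.antitone_rpow_neg {ε : ℝ} (hε : 0 < ε) :
    Antitone fun g : ℝ≥0∞ => g ^ (-ε) := fun g g' h => by
  simp only [ENNReal.rpow_neg]
  exact ENNReal.inv_le_inv.2 (ENNReal.rpow_le_rpow h hε.le)

/-- If c⁻¹ < 2 ^ n, then the power is at most 2 ^ (nε), and ε ≤ 1/(n + 1) suffices. -/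
theorem _root_.NNReal.exists_rpow_neg_le_two (c : ℝ≥0) :
    ∃ ε₀ : ℝ, 0 < ε₀ ∧ ∀ ε : ℝ, 0 < ε → ε ≤ ε₀ → c ^ (-ε) ≤ 2 := by
  obtain ⟨n, hn⟩ := pow_unbounded_of_one_lt c⁻¹ (one_lt_two (α := ℝ≥0))
  refine ⟨((n : ℝ) + 1)⁻¹, by positivity, fun ε hε hle => ?_⟩
  rw [NNReal.rpow_neg, ← NNReal.inv_rpow]
  calc c⁻¹ ^ ε ≤ ((2 : ℝ≥0) ^ (n : ℝ)) ^ ε :=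
        NNReal.rpow_le_rpow (by rw [NNReal.rpow_natCast]; exact hn.le) hε.le
    _ = 2 ^ (n * ε) := by rw [NNReal.rpow_mul]
    _ ≤ 2 ^ (1 : ℝ) := by
        refine NNReal.rpow_le_rpow_of_exponent_le one_le_two ?_
        rw [le_inv_comm₀ hε (by positivity), le_inv_comm₀ (by positivity) hε] at hle
        have h := mul_le_mul_of_nonneg_left hle (show (0 : ℝ) ≤ n + 1 by positivity)
        rw [mul_inv_cancel₀ (by positivity)] at h
        linarith
    _ = 2 := NNReal.rpow_one 2

/-- Frink's metrization: the infimum of chain sums of q = (u ∣ v)^(-ε) lies between q/2 and q once q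
satisfies the four-point inequality with factor 2. Points at distance zero have infinite product,
hence coincide. -/
theorem exists_isBoundaryMetric (𝓧 : CoarselyConvexSpace X) (O : X) :
    ∃ ε₀ : ℝ, 0 < ε₀ ∧ ∀ ε : ℝ, 0 < ε → ε ≤ ε₀ →
      ∃ m : MetricSpace (𝓧.Boundary O), 𝓧.IsBoundaryMetric O ε m := by
  obtain ⟨c, hc, hmin⟩ := exists_mul_min_min_gprod_le 𝓧 O
  obtain ⟨ε₀, hε₀, htwo⟩ := NNReal.exists_rpow_neg_le_two c
  refine ⟨ε₀, hε₀, fun ε hε hle => ?_⟩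
  have hanti := ENNReal.antitone_rpow_neg hε
  have hone : ∀ u v : 𝓧.Boundary O, 𝓧.gprod O (Sum.inr u) (Sum.inr v) ^ (-ε) ≤ 1 := fun u v =>
    (hanti (one_le_gprod u v)).trans_eq (by simp)
  set q : 𝓧.Boundary O → 𝓧.Boundary O → ℝ≥0 := fun u v =>
    (𝓧.gprod O (Sum.inr u) (Sum.inr v) ^ (-ε)).toNNReal with hq
  have hcoe : ∀ u v, (q u v : ℝ≥0∞) = 𝓧.gprod O (Sum.inr u) (Sum.inr v) ^ (-ε) := fun u v =>
    ENNReal.coe_toNNReal ((hone u v).trans_lt ENNReal.one_lt_top).ne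
  have hself : ∀ u, q u u = 0 := fun u => by
    simp only [hq, gprod_self, ENNReal.top_rpow_of_neg (neg_neg_of_pos hε), ENNReal.toNNReal_zero]
  have hcomm : ∀ u v, q u v = q v u := fun u v => by
    simp only [hq, gprod_comm (Sum.inr u) (Sum.inr v)]
  have hquasi : ∀ u v w z, q u z ≤ 2 * max (q u v) (max (q v w) (q w z)) := fun u v w z => by
    have h1 := hanti (hmin (Sum.inr u) (Sum.inr v) (Sum.inr w) (Sum.inr z))
    have h2 : min (𝓧.gprod O (Sum.inr u) (Sum.inr v)) (min (𝓧.gprod O (Sum.inr v) (Sum.inr w))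
        (𝓧.gprod O (Sum.inr w) (Sum.inr z))) ≠ 0 :=
      (zero_lt_one.trans_le (le_min (one_le_gprod u v)
        (le_min (one_le_gprod v w) (one_le_gprod w z)))).ne'
    simp only at h1
    rw [ENNReal.mul_rpow_of_ne_zero (by exact_mod_cast hc.ne') h2, hanti.map_min, hanti.map_min,
      ← hcoe, ← hcoe, ← hcoe, ← hcoe, ← ENNReal.coe_rpow_of_ne_zero hc.ne'] at h1
    have h3 : q u z ≤ c ^ (-ε) * max (q u v) (max (q v w) (q w z)) := by exact_mod_cast h1
    exact h3.trans (mul_le_mul_left (htwo ε hε hle) _)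
  have hle_two := PseudoMetricSpace.le_two_mul_dist_ofPreNNDist q hself hcomm hquasi
  have hdist_le := PseudoMetricSpace.dist_ofPreNNDist_le q hself hcomm
  let p : PseudoMetricSpace (𝓧.Boundary O) := PseudoMetricSpace.ofPreNNDist q hself hcomm
  let m : MetricSpace (𝓧.Boundary O) :=
    { p with
      eq_of_dist_eq_zero := fun {u v} h => by
        have h1 : (q u v : ℝ) ≤ 2 * 0 := (hle_two u v).trans_eq (congrArg (2 * ·) h)
        have h2 : q u v = 0 := by
          rw [mul_zero] at h1
          exact_mod_cast le_antisymm h1 (q u v).2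
        have h3 := hcoe u v
        rw [h2, ENNReal.coe_zero, eq_comm, ENNReal.rpow_eq_zero_iff] at h3
        rcases h3 with h3 | h3
        · exact absurd h3.1 (zero_lt_one.trans_le (one_le_gprod u v)).ne'
        · exact eq_of_gprod_eq_top h3.1 }
  refine ⟨m, 2⁻¹, by positivity, by norm_num [inv_lt_one_iff₀], fun u v => ?_⟩
  have h1 : q u v ≤ 2 * nndist u v := hle_two u v
  have h2 : nndist u v ≤ q u v := hdist_le u v
  rw [← hcoe, edist_nndist]
  refine ⟨?_, by exact_mod_cast h2⟩
  have h3 : 2⁻¹ * q u v ≤ nndist u v := by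
    rw [inv_mul_le_iff₀ two_pos]
    exact h1
  exact_mod_cast h3

end CoarselyConvexSpace

namespace CoarselyConvexSpace

variable {X Y : Type*} [MetricSpace X] [MetricSpace Y] {𝓧 : CoarselyConvexSpace X}
  {𝓨 : CoarselyConvexSpace Y} {O a : X} {b : Y}

/-! ### Convergence to boundary points -/

/-- A common late term has large product with both limits, so by the quasi-ultrametric inequality
the limits have infinite product. -/
theorem ConvergesTo.unique {z : ℕ → X ⊕ 𝓧.Boundary O} {u v : 𝓧.Boundary O}
    (hu : 𝓧.ConvergesTo O z (Sum.inr u)) (hv : 𝓧.ConvergesTo O z (Sum.inr v)) : u = v := by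
  obtain ⟨κ, hκ, h⟩ := exists_mul_min_gprod_le 𝓧 O
  refine eq_of_gprod_eq_top (ENNReal.eq_top_of_forall_nnreal_le fun r => ?_)
  obtain ⟨n, hn⟩ := exists_nat_ge (κ⁻¹ * r)
  obtain ⟨i, hi, hi'⟩ := ((hu (n + 1) (by omega)).and (hv (n + 1) (by omega))).exists
  simp only [entourage, mem_union, mem_ofPred_eq, Prod.mk.injEq, reduceCtorEq, false_and,
    exists_false, or_false] at hi hi'
  rw [gprod_comm] at hi'
  refine le_trans ?_ (h _ (z i) _)
  have hle : r ≤ κ * ((n + 1 : ℕ) : ℝ≥0) := by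
    rw [← inv_mul_le_iff₀ hκ]
    refine hn.trans ?_
    exact_mod_cast Nat.le_succ n
  calc (r : ℝ≥0∞) ≤ κ * ((n + 1 : ℕ) : ℝ≥0∞) := by exact_mod_cast hle
    _ ≤ _ := mul_le_mul_right (le_min hi.le hi'.le) _

theorem dist_le_lam_mul_len {γ : Segment X} (hγ : γ ∈ 𝓧.L) (h0 : γ.toFun 0 = O) {t : ℝ≥0}
    (ht : t ≤ γ.len) : dist (γ.toFun t) O ≤ 𝓧.lam * t + 𝓧.k := by
  have h := (𝓧.quasiGeodesic γ hγ t 0 ht zero_le).2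
  rwa [h0, NNReal.coe_zero, sub_zero, NNReal.abs_eq] at h

/-- A good segment from O shorter than 2θ(0) cannot leave the ball that defines the core. -/
theorem mem_segmentsFrom_of_lt_dist {γ : Segment X} (hγ : γ ∈ 𝓧.L) (h0 : γ.toFun 0 = O)
    (h : 2 * 𝓧.lam * 𝓧.θ 0 + 𝓧.k < dist (γ.toFun γ.len) O) : γ ∈ 𝓧.segmentsFrom O := by
  refine ⟨hγ, ?_, h0⟩
  have h1 := dist_le_lam_mul_len hγ h0 (le_refl γ.len)
  have h2 : 𝓧.lam * (2 * 𝓧.θ 0) ≤ 𝓧.lam * γ.len := by linarith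
  exact_mod_cast le_of_mul_le_mul_left h2 𝓧.lam_pos

theorem inl_notMem_core {x : X} (h : 2 * 𝓧.lam * 𝓧.θ 0 + 𝓧.k < dist x O) :
    Sum.inl x ∉ 𝓧.core O := by
  simpa [core] using h

theorem toCurve_mem_curvesTo {γ : Segment X} (hγ : γ ∈ 𝓧.segmentsFrom O) :
    γ.toCurve ∈ 𝓧.curvesTo O (Sum.inl (γ.toFun γ.len)) := ⟨γ, hγ, rfl, rfl⟩

/-- A sequence of points following a ray converges to the endpoint of the ray. -/
theorem convergesTo_of_dist_le (η : 𝓧.raysFrom O) {y : ℕ → X} {s : ℕ → ℝ≥0}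
    (hs : Tendsto s atTop atTop) {M : ℝ} (hM : ∀ n, dist (y n) (η.1 (s n)) ≤ M) :
    𝓧.ConvergesTo O (fun n => Sum.inl (y n)) (Sum.inr (Boundary.mk 𝓧 η)) := by
  intro N _
  obtain ⟨R, hR⟩ : ∃ R, R = 𝓧.θ (Real.toNNReal (M + 2 * (𝓧.k₁ + 1))) := ⟨_, rfl⟩
  obtain ⟨M', hM'⟩ : ∃ M', M' = M + 𝓧.lam * R + (𝓧.k + 2 * (𝓧.k₁ + 1)) := ⟨_, rfl⟩
  have hκ : 0 < 𝓧.shrink M' := shrink_pos _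
  have hlam := 𝓧.lam_pos
  have hs' : Tendsto (fun n => (s n : ℝ)) atTop atTop := NNReal.tendsto_coe_atTop.2 hs
  -- A good segment to y n has length within R of s n. The first threshold makes the shrunk common
  -- time exceed N; the second puts y n outside the core, by the lower quasi-geodesic bound.
  filter_upwards [hs'.eventually_gt_atTop (R + N / 𝓧.shrink M'),
    hs'.eventually_gt_atTop (R + 𝓧.lam * (2 * 𝓧.lam * 𝓧.θ 0 + 2 * 𝓧.k))] with n hn hn'
  obtain ⟨ζ, hζ, h0, hy⟩ := 𝓧.connected O (y n)
  have sζ := shadowed_toCurve hζ h0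
  have sη := shadowed_ofRay η.2
  have hmem : ζ.len ∈ ζ.toCurve.dom := ⟨zero_le, le_rfl⟩
  have hd : dist (ζ.toCurve.toFun ζ.len) ((Curve.ofRay η.1).toFun (s n)) ≤ M := by
    simpa [Segment.toCurve, Curve.ofRay, hy] using hM n
  have hlen := sζ.abs_sub_le sη hmem (mem_univ _) hd
  have hmin := sζ.dist_min_le sη hmem (mem_univ _) hd
  rw [← hR, ← hM'] at hmin
  rw [← hR] at hlen
  have hlen' := (abs_le.1 hlen).1
  have hfar : 2 * 𝓧.lam * 𝓧.θ 0 + 𝓧.k < dist (y n) O := by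
    have h := (𝓧.quasiGeodesic ζ hζ ζ.len 0 le_rfl zero_le).1
    rw [h0, NNReal.coe_zero, sub_zero, NNReal.abs_eq, hy] at h
    have h2 : 2 * 𝓧.lam * 𝓧.θ 0 + 2 * 𝓧.k < 𝓧.lam⁻¹ * ζ.len := by
      rw [lt_inv_mul_iff₀ hlam]
      linarith
    linarith
  left
  have hζO := mem_segmentsFrom_of_lt_dist hζ h0 (hy ▸ hfar)
  have hprod := curveProd_le_gprod (inl_notMem_core hfar) (inr_notMem_core (Boundary.mk 𝓧 η))
    (hy ▸ toCurve_mem_curvesTo hζO) ⟨η, rfl, rfl⟩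
  have hsh := sζ.shrink_mul_le_curveProd sη (sζ.mem_of_le _ hmem _ (min_le_left _ (s n)))
    (mem_univ _) hmin
  simp only [mem_ofPred_eq]
  rw [gprod_comm]
  refine lt_of_lt_of_le ?_ (hsh.trans hprod)
  have hlt : (N : ℝ) < 𝓧.shrink M' * (min ζ.len (s n) : ℝ≥0) := by
    rw [← div_lt_iff₀' (by exact_mod_cast hκ), NNReal.coe_min]
    have hR0 := R.2
    exact lt_min (by linarith) (by linarith [show (0 : ℝ) ≤ R from hR0])
  exact_mod_cast hlt

/-! ### Images of rays -/

/-- Any sequence of good segments from a point, of lengths tending to infinity, has a subsequence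
converging to a good ray. -/
theorem exists_subseq_tendsto_ray [ProperSpace X] {ζ : ℕ → Segment X}
    (hζ : ∀ n, ζ n ∈ 𝓧.L) (h0 : ∀ n, (ζ n).toFun 0 = O)
    (hlen : Tendsto (fun n => (ζ n).len) atTop atTop) :
    ∃ η ∈ 𝓧.raysFrom O, ∃ φ : ℕ → ℕ, StrictMono φ ∧
      ∀ m : ℕ, Tendsto (fun n => (ζ (φ n)).toFun m) atTop (𝓝 (η m)) := by
  -- Freezing each segment at its endpoint puts all its integer values in a product of closed balls,
  -- compact by properness. As the lengths diverge, the truncation is eventually invisible at each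
  -- m.
  obtain ⟨y, -, φ, hφ, hy⟩ := (isCompact_univ_pi fun m : ℕ =>
    isCompact_closedBall O (𝓧.lam * m + 𝓧.k)).tendsto_subseq
      (x := fun n (m : ℕ) => (ζ n).toFun (min (m : ℝ≥0) (ζ n).len)) fun n m _ => by
    refine Metric.mem_closedBall.2
      ((dist_le_lam_mul_len (hζ n) (h0 n) (min_le_right _ _)).trans ?_)
    have h : ((min (m : ℝ≥0) (ζ n).len : ℝ≥0) : ℝ) ≤ m := by exact_mod_cast min_le_left _ _
    linarith [mul_le_mul_of_nonneg_left h 𝓧.lam_pos.le]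
  have hlim : ∀ m : ℕ, Tendsto (fun n => (ζ (φ n)).toFun m) atTop (𝓝 (y m)) := fun m => by
    refine (tendsto_pi_nhds.1 hy m).congr' ?_
    filter_upwards [(hlen.comp hφ.tendsto_atTop).eventually_ge_atTop (m : ℝ≥0)] with n hn
    simp only [Function.comp_apply] at hn ⊢
    rw [min_eq_left hn]
  have hy0 : y 0 = O := tendsto_nhds_unique (hlim 0) (by simp [h0])
  refine ⟨fun t => y ⌊t⌋₊, ⟨⟨⟨fun n => ζ (φ n), fun n => ⟨hζ _, ?_⟩,
    hlen.comp hφ.tendsto_atTop, fun m => ?_⟩, fun t => ?_⟩, ?_⟩, φ, hφ, fun m => ?_⟩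
  · simp [h0, hy0]
  · simpa using hlim m
  · simp
  · simpa using hy0
  · simpa using hlim m

theorem exists_ray_dist_le [ProperSpace Y] {σ ρ : ℝ≥0 → ℝ≥0} (hσ : Tendsto σ atTop atTop)
    {H : ℝ} {f : X → Y} (hf : IsLargeScaleLipschitz f) (hrad : IsRadial 𝓧 a σ f)
    (hequiv : IsEquivariant 𝓧 𝓨 a b ρ H f) :
    ∃ M : ℝ, ∀ γ : 𝓧.raysFrom a, ∃ η : 𝓨.raysFrom b,
      ∀ t, dist (f (γ.1 t)) (η.1 (ρ t)) ≤ M := by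
  obtain ⟨A, B, hA, hB, hAB⟩ := hf
  obtain ⟨hab, hequiv⟩ := hequiv
  refine ⟨A * (𝓧.k₁ + 1) + B + H + (𝓨.k₁ + 1), fun γ => ?_⟩
  obtain ⟨⟨⟨s, hs, hlen, hlim⟩, hfl⟩, h0⟩ := γ.2
  rw [h0] at hs
  have hfar : Tendsto (fun n => dist (f ((s n).toFun (s n).len)) b) atTop atTop := by
    refine tendsto_atTop_mono' _ ?_ (NNReal.tendsto_coe_atTop.2 (hσ.comp hlen))
    filter_upwards [hlen.eventually_ge_atTop (2 * 𝓧.θ 0)] with n hn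
    rw [← hab]
    exact hrad (s n) ⟨(hs n).1, hn, (hs n).2⟩ _ le_rfl
  choose ζ hζ hζ0 hζf using fun n => 𝓨.connected b (f ((s n).toFun (s n).len))
  have hζlen : Tendsto (fun n => (ζ n).len) atTop atTop := by
    rw [← NNReal.tendsto_coe_atTop]
    have h : Tendsto (fun n => 𝓨.lam * ((ζ n).len : ℝ) + 𝓨.k) atTop atTop := by
      refine tendsto_atTop_mono (fun n => ?_) hfar
      rw [← hζf]
      exact dist_le_lam_mul_len (hζ n) (hζ0 n) le_rfl
    exact (tendsto_const_mul_atTop_of_pos 𝓨.lam_pos).1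
      ((tendsto_atTop_add_const_right _ (-𝓨.k) h).congr fun n => by ring)
  obtain ⟨η, hη, φ, hφ, hφη⟩ := exists_subseq_tendsto_ray hζ hζ0 hζlen
  refine ⟨⟨η, hη⟩, fun t => ?_⟩
  have hφ' := hφ.tendsto_atTop
  -- For a fixed t one late index suffices: both approximations are within k₁ + 1, and the two
  -- segments are long enough for equivariance to apply at time t.
  obtain ⟨n, hn1, hn2, hn3, hn4, hn5, hn6⟩ :=
    ((eventually_dist_le (fun n => (hs (φ n)).1) (hlen.comp hφ')
        (fun m => (hlim m).comp hφ') hfl t one_pos).and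
      ((eventually_dist_le (fun n => hζ (φ n)) (hζlen.comp hφ') hφη hη.1.2 (ρ t) one_pos).and
      (((hlen.comp hφ').eventually_ge_atTop t).and
      (((hζlen.comp hφ').eventually_ge_atTop (ρ t)).and
      (((hlen.comp hφ').eventually_ge_atTop (2 * 𝓧.θ 0)).and
      ((hfar.comp hφ').eventually_gt_atTop (2 * 𝓨.lam * 𝓨.θ 0 + 𝓨.k))))))).exists
  have h1 := hequiv (s (φ n)) ⟨(hs _).1, hn5, (hs _).2⟩ (ζ (φ n))
    (mem_segmentsFrom_of_lt_dist (hζ _) (hζ0 _) (by rw [hζf]; exact hn6)) (hζf _) t hn3 hn4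
  have h2 := hn1 t le_rfl
  have h3 := hn2 (ρ t) le_rfl
  have h4 := hAB (γ.1 t) ((s (φ n)).toFun t)
  rw [dist_comm (γ.1 t)] at h4
  have h5 := mul_le_mul_of_nonneg_left h2 (zero_le_one.trans hA)
  simp only at h3 ⊢
  linarith [dist_triangle4 (f (γ.1 t)) (f ((s (φ n)).toFun t)) ((ζ (φ n)).toFun (ρ t)) (η (ρ t))]

/-- The value is read off from a chosen representative. Any other representative stays within D of
it, so its image follows the same ray with the larger constant AD + B + M. -/
theorem exists_boundary_map [ProperSpace Y] {σ ρ : ℝ≥0 → ℝ≥0} (hσ : Tendsto σ atTop atTop)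
    {H : ℝ} {f : X → Y} (hf : IsLargeScaleLipschitz f) (hrad : IsRadial 𝓧 a σ f)
    (hequiv : IsEquivariant 𝓧 𝓨 a b ρ H f) :
    ∃ (F : 𝓧.Boundary a → 𝓨.Boundary b) (M : ℝ), ∀ γ : 𝓧.raysFrom a, ∃ η : 𝓨.raysFrom b,
      Boundary.mk 𝓨 η = F (Boundary.mk 𝓧 γ) ∧ ∀ t, dist (f (γ.1 t)) (η.1 (ρ t)) ≤ M := by
  obtain ⟨M, hM⟩ := exists_ray_dist_le hσ hf hrad hequiv
  obtain ⟨A, B, hA, hB, hAB⟩ := hf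
  choose r hr using fun u : 𝓧.Boundary a => u.exists_rep
  choose η hη using hM
  refine ⟨fun u => Boundary.mk 𝓨 (η (r u)), A * 𝓧.D + B + M, fun γ => ⟨_, rfl, fun t => ?_⟩⟩
  have h1 := dist_le_D_of_mk_eq (hr (Boundary.mk 𝓧 γ)).symm t
  have h2 := mul_le_mul_of_nonneg_left h1 (zero_le_one.trans hA)
  linarith [hAB (γ.1 t) ((r (Boundary.mk 𝓧 γ)).1 t), hη (r (Boundary.mk 𝓧 γ)) t,
    dist_triangle (f (γ.1 t)) (f ((r (Boundary.mk 𝓧 γ)).1 t))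
      ((η (r (Boundary.mk 𝓧 γ))).1 (ρ t))]

/-! ### Products of images -/

theorem isVisual_of_isEquivariant {σ ρ : ℝ≥0 → ℝ≥0} (hσ : Tendsto σ atTop atTop)
    (hρ : Tendsto ρ atTop atTop) (hρle : ∀ t, ρ t ≤ t) {H : ℝ} {f : X → Y}
    (hf : IsLargeScaleLipschitz f) (hrad : IsRadial 𝓧 a σ f)
    (hequiv : IsEquivariant 𝓧 𝓨 a b ρ H f) : IsVisual 𝓧 𝓨 a b f := by
  refine ⟨hf, fun x y hxy => ?_⟩
  obtain ⟨A, B, hA, hB, hAB⟩ := hf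
  obtain ⟨hab, hequiv⟩ := hequiv
  rw [ENNReal.tendsto_nhds_top_iff_nnreal] at hxy ⊢
  intro N
  obtain ⟨M, hM⟩ : ∃ M, M = A * (𝓧.E * (2 * 𝓧.D + 2) + 𝓧.D) + B + 2 * H := ⟨_, rfl⟩
  -- The time t is chosen so that `shrink M` times ρ t exceeds N. The length T then forces, by
  -- radiality, the image endpoint out of the core and its good segments to have length at least t ≥
  -- ρ t.
  obtain ⟨t, ht⟩ := (hρ.eventually_gt_atTop ((𝓨.shrink M)⁻¹ * N)).exists
  obtain ⟨T, hT⟩ := eventually_atTop.1 ((NNReal.tendsto_coe_atTop.2 hσ).eventually_gt_atTop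
    (2 * 𝓨.lam * 𝓨.θ 0 + 𝓨.k + 𝓨.lam * t))
  -- images of endpoints of long segments are far from `b`, and good segments to them are long
  have key : ∀ γ ∈ 𝓧.segmentsFrom a, T ≤ γ.len → t ≤ γ.len →
      Sum.inl (f (γ.toFun γ.len)) ∉ 𝓨.core b ∧ ∃ ζ ∈ 𝓨.segmentsFrom b,
        ζ.toFun ζ.len = f (γ.toFun γ.len) ∧ ρ t ≤ ζ.len ∧
          dist (f (γ.toFun t)) (ζ.toFun (ρ t)) < H := fun γ hγ hTγ htγ => by
    obtain ⟨ζ, hζ, h0, hζf⟩ := 𝓨.connected b (f (γ.toFun γ.len))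
    have h1 := hrad γ hγ _ le_rfl
    rw [hab] at h1
    have h2 := hT _ hTγ
    have h3 := dist_le_lam_mul_len hζ h0 (le_refl ζ.len)
    rw [hζf] at h3
    have hlam := 𝓨.lam_pos
    have h4 : 0 ≤ 𝓨.lam * t := by positivity
    have h5 : 0 ≤ 2 * 𝓨.lam * 𝓨.θ 0 := by positivity
    have hfar : 2 * 𝓨.lam * 𝓨.θ 0 + 𝓨.k < dist (f (γ.toFun γ.len)) b := by linarith
    have hζb := mem_segmentsFrom_of_lt_dist hζ h0 (hζf ▸ hfar)
    have hlen : t ≤ ζ.len := by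
      have : 𝓨.lam * t ≤ 𝓨.lam * ζ.len := by linarith
      exact_mod_cast le_of_mul_le_mul_left this hlam
    have hρζ := (hρle t).trans hlen
    exact ⟨inl_notMem_core hfar, ζ, hζb, hζf, hρζ, hequiv γ hγ ζ hζb hζf t htγ hρζ⟩
  filter_upwards [hxy (max t T)] with n hn
  obtain ⟨-, -, c, hc, c', hc', S, hS, hS', hNS, hd⟩ := exists_of_lt_gprod hn
  have hmax : max t T ≤ S := (ENNReal.coe_lt_coe.1 hNS).le
  have htS := (le_max_left _ _).trans hmax
  have hTS := (le_max_right _ _).trans hmax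
  have h1 := (shadowed_of_mem_curvesTo hc).dist_le_of_le (shadowed_of_mem_curvesTo hc') hS hS'
    htS hd
  obtain ⟨γ, hγ, hx, rfl⟩ := hc
  obtain ⟨η, hη, hy, rfl⟩ := hc'
  obtain ⟨hcore, ζ, hζ, hζf, hρζ, hdζ⟩ := key γ hγ (hTS.trans hS.2) (htS.trans hS.2)
  obtain ⟨hcore', ζ', hζ', hζf', hρζ', hdζ'⟩ := key η hη (hTS.trans hS'.2) (htS.trans hS'.2)
  rw [hx] at hcore hζf
  rw [hy] at hcore' hζf'
  have hprod := curveProd_le_gprod hcore hcore' (hζf ▸ toCurve_mem_curvesTo hζ)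
    (hζf' ▸ toCurve_mem_curvesTo hζ')
  have hdist : dist (ζ.toCurve.toFun (ρ t)) (ζ'.toCurve.toFun (ρ t)) ≤ M := by
    have h2 := hAB (γ.toFun t) (η.toFun t)
    have h3 := mul_le_mul_of_nonneg_left h1 (zero_le_one.trans hA)
    rw [dist_comm] at hdζ
    simp only [Segment.toCurve] at h3 ⊢
    linarith [dist_triangle4 (ζ.toFun (ρ t)) (f (γ.toFun t)) (f (η.toFun t)) (ζ'.toFun (ρ t))]
  refine lt_of_lt_of_le ?_ (((shadowed_toCurve hζ.1 hζ.2.2).shrink_mul_le_curveProd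
    (shadowed_toCurve hζ'.1 hζ'.2.2) ⟨zero_le, hρζ⟩ ⟨zero_le, hρζ'⟩ hdist).trans hprod)
  rw [ENNReal.coe_lt_coe]
  rwa [inv_mul_lt_iff₀ (shrink_pos _)] at ht

theorem exists_gprod_le_mul_gprod {ρ : ℝ≥0 → ℝ≥0} (hρ0 : ρ 0 = 0) {A B : ℝ} (hA : 0 < A)
    (hB : 0 ≤ B) (hρ : ∀ s t : ℝ≥0, A * |(t : ℝ) - s| - B ≤ |(ρ t : ℝ) - ρ s|)
    {f : X → Y} (hf : IsLargeScaleLipschitz f) {F : 𝓧.Boundary a → 𝓨.Boundary b} {M : ℝ}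
    (hF : ∀ γ : 𝓧.raysFrom a, ∃ η : 𝓨.raysFrom b,
      Boundary.mk 𝓨 η = F (Boundary.mk 𝓧 γ) ∧ ∀ t, dist (f (γ.1 t)) (η.1 (ρ t)) ≤ M) :
    ∃ κ : ℝ≥0, 0 < κ ∧ ∀ u v : 𝓧.Boundary a, 𝓧.gprod a (Sum.inr u) (Sum.inr v) ≤
      κ * 𝓨.gprod b (Sum.inr (F u)) (Sum.inr (F v)) := by
  obtain ⟨A', B', hA', hB', hAB⟩ := hf
  lift A to ℝ≥0 using hA.le
  lift B to ℝ≥0 using hB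
  have hA0 : 0 < A := by exact_mod_cast hA
  have hρt : ∀ t, t ≤ A⁻¹ * (ρ t + B) := fun t => by
    have h := hρ 0 t
    rw [hρ0, NNReal.coe_zero, sub_zero, sub_zero, NNReal.abs_eq, NNReal.abs_eq] at h
    rw [le_inv_mul_iff₀ hA0]
    have h' : (A : ℝ) * t ≤ ρ t + B := by linarith [show A * (t : ℝ) - B ≤ ρ t from h]
    exact_mod_cast h'
  obtain ⟨R, hR⟩ : ∃ R, R = M + (A' * (2 * 𝓧.D + 2) + B') + M := ⟨_, rfl⟩
  have hκ : 0 < 𝓨.shrink R := shrink_pos _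
  -- From t ≤ A⁻¹(ρ t + B) and ρ t ≤ (shrink R)⁻¹ g, with g the image product; B ≤ Bg because g ≥ 1.
  refine ⟨A⁻¹ * ((𝓨.shrink R)⁻¹ + B), by positivity, fun u v => le_of_forall_lt fun N hN => ?_⟩
  obtain ⟨-, -, c, ⟨γ, rfl, rfl⟩, c', ⟨γ', rfl, rfl⟩, t, -, -, hNt, hd⟩ := exists_of_lt_gprod hN
  refine hNt.trans_le ?_
  obtain ⟨η, hη, hdη⟩ := hF γ
  obtain ⟨η', hη', hdη'⟩ := hF γ'
  have hdist : dist ((Curve.ofRay η.1).toFun (ρ t)) ((Curve.ofRay η'.1).toFun (ρ t)) ≤ R := by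
    have h2 := hAB (γ.1 t) (γ'.1 t)
    have h3 := mul_le_mul_of_nonneg_left hd (zero_le_one.trans hA')
    have h4 := hdη t
    rw [dist_comm] at h4
    simp only [Curve.ofRay] at h3 ⊢
    linarith [dist_triangle4 (η.1 (ρ t)) (f (γ.1 t)) (f (γ'.1 t)) (η'.1 (ρ t)), hdη' t]
  have hprod := ((shadowed_ofRay η.2).shrink_mul_le_curveProd (shadowed_ofRay η'.2)
    (mem_univ _) (mem_univ _) hdist).trans (curveProd_ofRay_le_gprod η η')
  have hone := one_le_gprod (Boundary.mk 𝓨 η) (Boundary.mk 𝓨 η')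
  rw [hη, hη'] at hprod hone
  generalize 𝓨.gprod b _ _ = g at hprod hone ⊢
  induction g with
  | top => simp [ENNReal.mul_top, hA0.ne', hκ.ne']
  | coe g =>
    rw [← ENNReal.coe_mul, ENNReal.coe_le_coe]
    rw [ENNReal.coe_le_coe] at hprod
    have hone' : 1 ≤ g := by exact_mod_cast hone
    refine (hρt t).trans ?_
    rw [mul_assoc, add_mul]
    refine mul_le_mul_right (add_le_add ?_ (le_mul_of_one_le_right zero_le hone')) _
    rwa [le_inv_mul_iff₀ hκ]

/-- The chain is d(Fu, Fv) ≤ (Fu ∣ Fv)^(-ε) ≤ κ^ε (u ∣ v)^(-ε) ≤ κ^ε K⁻¹ d(u, v), with K the lower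
constant of the metric on the source. -/
theorem exists_lipschitzWith {ε : ℝ} (hε : 0 < ε) {κ : ℝ≥0} (hκ : 0 < κ)
    {F : 𝓧.Boundary a → 𝓨.Boundary b}
    (hF : ∀ u v : 𝓧.Boundary a, 𝓧.gprod a (Sum.inr u) (Sum.inr v) ≤
      κ * 𝓨.gprod b (Sum.inr (F u)) (Sum.inr (F v)))
    (mX : MetricSpace (𝓧.Boundary a)) (mY : MetricSpace (𝓨.Boundary b))
    (hX : 𝓧.IsBoundaryMetric a ε mX) (hY : 𝓨.IsBoundaryMetric b ε mY) :
    ∃ K : ℝ≥0, LipschitzWith K F := by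
  obtain ⟨K, hK, -, hKX⟩ := hX
  obtain ⟨K', -, -, hKY⟩ := hY
  refine ⟨κ ^ ε * K⁻¹, fun u v => ?_⟩
  have h1 := ENNReal.antitone_rpow_neg hε (hF u v)
  have h2 := one_le_gprod (F u) (F v)
  simp only at h1
  rw [ENNReal.mul_rpow_of_ne_zero (by exact_mod_cast hκ.ne') (zero_lt_one.trans_le h2).ne',
    ENNReal.rpow_neg, mul_comm, ← div_eq_mul_inv, ENNReal.div_le_iff_le_mul (.inl ?_) (.inl ?_)]
    at h1
  · refine (hKY _ _).2.trans (h1.trans ?_)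
    rw [mul_comm, ENNReal.coe_mul, ENNReal.coe_rpow_of_ne_zero hκ.ne', mul_assoc,
      ENNReal.coe_inv hK.ne']
    refine mul_le_mul_right ?_ _
    rw [← ENNReal.mul_le_iff_le_inv (by exact_mod_cast hK.ne') ENNReal.coe_ne_top]
    exact (hKX u v).1
  · rw [← ENNReal.coe_rpow_of_ne_zero hκ.ne']
    exact_mod_cast (NNReal.rpow_pos hκ).ne'
  · rw [← ENNReal.coe_rpow_of_ne_zero hκ.ne']
    exact ENNReal.coe_ne_top

end CoarselyConvexSpace

/-! ### The corollary -/

theorem corollary3 {X Y : Type*} [MetricSpace X] [ProperSpace X] [MetricSpace Y] [ProperSpace Y]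
    (𝓧 : CoarselyConvexSpace X) (𝓨 : CoarselyConvexSpace Y) (a : X) (b : Y)
    (σ ρ : ℝ≥0 → ℝ≥0) (hσ : IsRoughIsometricContraction σ) (hρ : IsRoughIsometricContraction ρ)
    (H : ℝ) (hH : 0 < H) (f : X → Y) (hf : IsLargeScaleLipschitz f)
    (hrad : CoarselyConvexSpace.IsRadial 𝓧 a σ f)
    (hequiv : CoarselyConvexSpace.IsEquivariant 𝓧 𝓨 a b ρ H f) :
    -- `f` is visual, so it has a unique induced map `F = ∂f`
    CoarselyConvexSpace.IsVisual 𝓧 𝓨 a b f ∧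
    ∃ F : 𝓧.Boundary a → 𝓨.Boundary b,
      CoarselyConvexSpace.IsInducedMap 𝓧 𝓨 a b f F ∧
      (∀ F' : 𝓧.Boundary a → 𝓨.Boundary b,
        CoarselyConvexSpace.IsInducedMap 𝓧 𝓨 a b f F' → F' = F) ∧
      -- for small `ε` the metrics `d_ε` exist on both boundaries
      (∃ ε₀ : ℝ, 0 < ε₀ ∧ ∀ ε : ℝ, 0 < ε → ε ≤ ε₀ →
        (∃ mX : MetricSpace (𝓧.Boundary a), 𝓧.IsBoundaryMetric a ε mX) ∧
        (∃ mY : MetricSpace (𝓨.Boundary b), 𝓨.IsBoundaryMetric b ε mY)) ∧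
      -- with respect to all such metrics `∂f` is Lipschitz
      (∀ ε : ℝ, 0 < ε →
        ∀ (mX : MetricSpace (𝓧.Boundary a)) (mY : MetricSpace (𝓨.Boundary b)),
          𝓧.IsBoundaryMetric a ε mX → 𝓨.IsBoundaryMetric b ε mY →
            ∃ K : ℝ≥0, LipschitzWith K F) := by
  obtain ⟨⟨τ, -, -, hσlim, -⟩, -⟩ := hσ
  obtain ⟨⟨τ', -, hρ0, hρlim, hρle, -, -⟩, A, B, hA, hB, hAB⟩ := hρ
  obtain ⟨F, M, hF⟩ := CoarselyConvexSpace.exists_boundary_map hσlim hf hrad hequiv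
  obtain ⟨κ, hκ, hFκ⟩ := CoarselyConvexSpace.exists_gprod_le_mul_gprod hρ0 hA hB hAB hf hF
  obtain ⟨εX, hεX, hmX⟩ := 𝓧.exists_isBoundaryMetric a
  obtain ⟨εY, hεY, hmY⟩ := 𝓨.exists_isBoundaryMetric b
  have hind : CoarselyConvexSpace.IsInducedMap 𝓧 𝓨 a b f F := fun γ => by
    obtain ⟨η, hη, hd⟩ := hF γ
    rw [← hη]
    exact CoarselyConvexSpace.convergesTo_of_dist_le η
      (hρlim.comp tendsto_natCast_atTop_atTop) fun n => hd n
  refine ⟨CoarselyConvexSpace.isVisual_of_isEquivariant hσlim hρlim hρle hf hrad hequiv,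
    F, hind, fun F' hF' => ?_, ⟨min εX εY, lt_min hεX hεY, fun ε hε hle =>
      ⟨hmX ε hε (hle.trans (min_le_left _ _)), hmY ε hε (hle.trans (min_le_right _ _))⟩⟩,
    fun ε hε mX mY hX hY => CoarselyConvexSpace.exists_lipschitzWith hε hκ hFκ mX mY hX hY⟩
  funext u
  obtain ⟨γ, rfl⟩ := u.exists_rep
  exact CoarselyConvexSpace.ConvergesTo.unique (hF' γ) (hind γ)
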